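/- Let $X$ be a real Banach space, let $K \subset X$ be compact, and let $n \ge 0$ be an integer. Let $S^n = \{x \in \mathbb{R}^{n+1} : \|x\| = 1\}$ be the Euclidean unit sphere. Define the sphere embedding width of $K$ by $$ s_n(K)_X := \sup_{c} \inf_{z \in S^n} \|c(z)\|_X, $$ where the supremum is over all continuous odd maps $c : S^n \to K$ (that is, $c(-z) = -c(z)$ for all $z \in S^n$), and is $0$ if there are no such maps. Define the manifold width of $K$ by $$ \delta_n(K)_X := \inf_{a, M} \sup_{f \in K} \|f - M(a(f))\|_X, $$ where the infimum is over all pairs of continuous maps $a : K \to \mathbb{R}^n$ and $M : \mathbb{R}^n \to X$, and the supremum over $K$ is $0$ if $K$ is empty. Then $$ s_n(K)_X \le \delta_n(K)_X . $$ -/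

import Mathlib

open scoped ENNReal

/-- The unit sphere `S^n = {x ∈ ℝ^{n+1} : ‖x‖ = 1}` (Euclidean norm). -/
abbrev UnitSphere (n : ℕ) : Type :=
  Metric.sphere (0 : EuclideanSpace ℝ (Fin (n + 1))) 1

/-- The manifold `n`-width of `K ⊆ X`: the infimum over continuous encoders `a : K → ℝⁿ` and
continuous decoders `M : ℝⁿ → X` of `sup_{f ∈ K} ‖f - M (a f)‖`, as an extended nonnegative
real, so that suprema and infima have no default values (the norm is read in `ℝ≥0∞`). -/
noncomputable def manifoldWidth {X : Type*} [NormedAddCommGroup X] [NormedSpace ℝ X]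
    (n : ℕ) (K : Set X) : ℝ≥0∞ :=
  ⨅ (a : C(K, EuclideanSpace ℝ (Fin n))) (M : C(EuclideanSpace ℝ (Fin n), X)),
    ⨆ f : K, ‖(f : X) - M (a f)‖ₑ

/-- The sphere embedding `n`-width of `K ⊆ X`: the supremum over continuous odd maps
`c : S^n → K` of `inf_{z ∈ S^n} ‖c z‖`. If there is no such map, the supremum is `0`. -/
noncomputable def sphereEmbeddingWidth {X : Type*} [NormedAddCommGroup X] [NormedSpace ℝ X]
    (n : ℕ) (K : Set X) : ℝ≥0∞ :=
  ⨆ (c : C(UnitSphere n, K)) (_ : ∀ z : UnitSphere n, (c (-z) : X) = -(c z : X)),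
    ⨅ z : UnitSphere n, ‖(c z : X)‖ₑ

/-!
For an encoder `a`, a decoder `M` and an odd map `c`, the Borsuk–Ulam theorem applied to `a ∘ c`
gives antipodal points `±z` with the same code. The decoder then answers both `c z` and `-c z` with
the same vector `y`, and `2 c z = (c z - y) - (-c z - y)` shows that one of the two errors is at
least `‖c z‖`.

The Borsuk–Ulam theorem itself is proved algebraically. By the Stone–Weierstrass theorem an odd map
`S^n → ℝⁿ` is close to a system of `n` odd polynomials, which multiplication by powers of `∑ x_j²`
makes homogeneous of one odd degree `d`. It suffices to find a zero of the perturbed forms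
`x_i ^ d + t f_i(x₀, …, x_n)`, `1 ≤ i ≤ n`, on the sphere for arbitrarily large `t`, as then
`|f_i| ≤ 1 / t` there. Setting `x₀ = 1` leaves `n` equations of degree at most `d` in `n` unknowns.
At `t = 0` the monomials with all exponents below `d` form a basis of the quotient algebra;
expressing linear independence by minors, which are polynomials in `t`, this persists for all but
countably many `t`. So the quotient algebra has the odd dimension `d ^ n` over `ℝ`. If it had no
real point, all its residue fields would be `ℂ`, and its dimension would be even.
-/

section LinearAlgebra

variable {ι R M : Type*}

theorem finrank_span_image_eq_card [Ring R] [StrongRankCondition R] [AddCommGroup M] [Module R M]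
    {v : ι → M} (hv : LinearIndependent R v) (s : Set ι) :
    Module.finrank R (Submodule.span R (v '' s)) = Nat.card s := by
  rw [Set.image_eq_range]
  exact Module.finrank_eq_nat_card_basis
    (Module.Basis.span (hv.comp (fun i : s => (i : ι)) Subtype.val_injective))

open scoped Polynomial in
theorem countable_setOf_not_linearIndependent_row_map_eval [CommRing R] [IsDomain R] [Countable ι]
    [DecidableEq ι] (A : Matrix ι ι R[X]) {t₀ : R} (h₀ : A.map (Polynomial.eval t₀) = 1) :
    {t | ¬ LinearIndependent R (A.map (Polynomial.eval t)).row}.Countable := by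
  let minor (s : Finset ι) : Matrix s s R[X] := A.submatrix (↑) (↑)
  have eval_det (s : Finset ι) (t : R) : (minor s).det.eval t =
      ((A.map (Polynomial.eval t)).submatrix ((↑) : s → ι) (↑)).det := by
    rw [← Polynomial.coe_evalRingHom, RingHom.map_det]
    rfl
  have det_ne_zero (s : Finset ι) : (minor s).det ≠ 0 := by
    intro hs
    have := eval_det s t₀
    rw [hs, h₀, Matrix.submatrix_one _ Subtype.val_injective, Matrix.det_one,
      Polynomial.eval_zero] at this
    exact zero_ne_one this
  refine (Set.countable_iUnion fun s =>
    (Polynomial.finite_setOfPred_isRoot (det_ne_zero s)).countable).mono fun t ht => ?_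
  by_contra hroot
  refine ht (linearIndependent_iff_finset_linearIndependent.2 fun s => ?_)
  have det_minor_ne_zero :
      ((A.map (Polynomial.eval t)).submatrix ((↑) : s → ι) ((↑) : s → ι)).det ≠ 0 := by
    rw [← eval_det]
    exact fun h => hroot (Set.mem_iUnion.2 ⟨s, h⟩)
  exact LinearIndependent.of_comp (LinearMap.funLeft R R ((↑) : s → ι))
    (Matrix.linearIndependent_rows_of_det_ne_zero det_minor_ne_zero)

end LinearAlgebra

section RealPoints

theorem dvd_finrank_of_isFiniteLength {k B M : Type*} [Field k] [CommRing B] [Algebra k B] {d : ℕ}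
    (hd : ∀ I : Ideal B, I.IsMaximal → d ∣ Module.finrank k (B ⧸ I)) [AddCommGroup M] [Module B M]
    (hM : IsFiniteLength B M) :
    ∀ [Module k M] [IsScalarTower k B M], d ∣ Module.finrank k M := by
  induction hM with
  | of_subsingleton =>
    intro _ _
    rw [Module.finrank_zero_of_subsingleton]
    exact dvd_zero d
  | @of_simple_quotient M _ _ N hsimple _ ih =>
    intro _ _
    by_cases hfin : Module.Finite k M
    · obtain ⟨I, hI, ⟨e⟩⟩ := isSimpleModule_iff_quot_maximal.1 hsimple
      have finrank_quotient : Module.finrank k (M ⧸ N.restrictScalars k) =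
          Module.finrank k (B ⧸ I) :=
        ((Submodule.Quotient.restrictScalarsEquiv k N).trans (e.restrictScalars k)).finrank_eq
      rw [← (N.restrictScalars k).finrank_quotient_add_finrank, finrank_quotient]
      exact dvd_add (hd I hI) ih
    · rw [Module.finrank_of_not_finite hfin]
      exact dvd_zero d

theorem nonempty_algHom_real_of_odd_finrank {B : Type*} [CommRing B] [Algebra ℝ B]
    (hodd : Odd (Module.finrank ℝ B)) : Nonempty (B →ₐ[ℝ] ℝ) := by
  have : FiniteDimensional ℝ B := Module.finite_of_finrank_pos hodd.pos
  have : IsArtinianRing B := IsArtinianRing.of_finite ℝ B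
  by_contra hempty
  have two_dvd_residue_degree (I : Ideal B) (hI : I.IsMaximal) : 2 ∣ Module.finrank ℝ (B ⧸ I) := by
    let : Field (B ⧸ I) := Ideal.Quotient.field I
    rcases Real.nonempty_algEquiv_or (B ⧸ I) with ⟨⟨e⟩⟩ | ⟨⟨e⟩⟩
    · exact absurd ⟨(e : (B ⧸ I) →ₐ[ℝ] ℝ).comp (Ideal.Quotient.mkₐ ℝ I)⟩ hempty
    · rw [e.toLinearEquiv.finrank_eq, Complex.finrank_real_complex]
  exact hodd.not_two_dvd_nat (dvd_finrank_of_isFiniteLength two_dvd_residue_degree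
    (isFiniteLength_iff_isNoetherian_isArtinian.2 ⟨inferInstance, inferInstance⟩))

theorem exists_forall_mem_eval_eq_zero_of_odd_finrank {σ : Type*} (I : Ideal (MvPolynomial σ ℝ))
    (hodd : Odd (Module.finrank ℝ (MvPolynomial σ ℝ ⧸ I))) :
    ∃ x : σ → ℝ, ∀ p ∈ I, MvPolynomial.eval x p = 0 := by
  obtain ⟨φ⟩ := nonempty_algHom_real_of_odd_finrank hodd
  let ψ : MvPolynomial σ ℝ →ₐ[ℝ] ℝ := φ.comp (Ideal.Quotient.mkₐ ℝ I)
  refine ⟨ψ ∘ MvPolynomial.X, fun p hp => ?_⟩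
  rw [← MvPolynomial.aeval_eq_eval, ← MvPolynomial.aeval_unique ψ]
  change φ (Ideal.Quotient.mk I p) = 0
  rw [Ideal.Quotient.eq_zero_iff_mem.2 hp, map_zero]

end RealPoints

section Polynomials

open MvPolynomial

variable {σ τ R : Type*} [CommSemiring R]

theorem span_range_eq_top_of_totalDegree_le {k : Type*} [Field k] [Finite σ]
    {v : (σ →₀ ℕ) → MvPolynomial σ k} (hv : LinearIndependent k v)
    (hdeg : ∀ m, (v m).totalDegree ≤ m.degree) : Submodule.span k (Set.range v) = ⊤ := by
  refine eq_top_iff.2 fun p _ => ?_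
  let s : Set (σ →₀ ℕ) := {m | m.degree ≤ p.totalDegree}
  have span_le : Submodule.span k (v '' s) ≤ restrictTotalDegree σ k p.totalDegree := by
    refine Submodule.span_le.2 ?_
    rintro _ ⟨m, hm, rfl⟩
    exact (mem_restrictTotalDegree _ _ _).2 ((hdeg m).trans hm)
  have span_eq : Submodule.span k (v '' s) = restrictTotalDegree σ k p.totalDegree := by
    -- Both sides have as many basis vectors as there are monomials of degree `≤ p.totalDegree`.
    refine Submodule.eq_of_le_of_finrank_le span_le ?_
    rw [finrank_span_image_eq_card hv]
    exact (Module.finrank_eq_nat_card_basis (basisRestrictSupport k s)).le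
  exact Submodule.span_mono (Set.image_subset_range v s)
    (span_eq ▸ (mem_restrictTotalDegree _ _ _).2 le_rfl)

theorem totalDegree_aeval_le (p : MvPolynomial σ R) {f : σ → MvPolynomial τ R} {d : ℕ}
    (hf : ∀ i, (f i).totalDegree ≤ d) : (aeval f p).totalDegree ≤ p.totalDegree * d := by
  rw [aeval_def, eval₂_eq]
  refine totalDegree_finsetSum_le fun m hm => ?_
  calc (algebraMap R (MvPolynomial τ R) (coeff m p) * ∏ i ∈ m.support, f i ^ m i).totalDegree
      ≤ 0 + ∑ i ∈ m.support, m i * d := by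
        refine (totalDegree_mul _ _).trans (add_le_add (totalDegree_C _).le ?_)
        refine (totalDegree_finsetProd _ _).trans (Finset.sum_le_sum fun i _ => ?_)
        exact (totalDegree_pow _ _).trans (Nat.mul_le_mul_left _ (hf i))
    _ = m.degree * d := by rw [zero_add, Finsupp.degree_apply, Finset.sum_mul]
    _ ≤ p.totalDegree * d := Nat.mul_le_mul_right _ (le_totalDegree hm)

theorem eval_smul_of_isHomogeneous {p : MvPolynomial σ R} {d : ℕ} (hp : p.IsHomogeneous d) (c : R)
    (x : σ → R) : eval (c • x) p = c ^ d * eval x p := by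
  rw [eval_eq, eval_eq, Finset.mul_sum]
  refine Finset.sum_congr rfl fun m hm => ?_
  simp only [Pi.smul_apply, smul_eq_mul, mul_pow, Finset.prod_mul_distrib,
    Finset.prod_pow_eq_pow_sum, hp.degree_eq_sum_deg_support hm]
  exact mul_left_comm _ _ _

theorem sum_range_homogeneousComponent {p : MvPolynomial σ R} {N : ℕ} (hN : p.totalDegree < N) :
    ∑ i ∈ Finset.range N, homogeneousComponent i p = p := by
  conv_rhs => rw [← sum_homogeneousComponent p]
  refine (Finset.sum_subset (Finset.range_mono hN) fun i _ hi => ?_).symm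
  exact homogeneousComponent_eq_zero _ _ (by simpa using hi)

/-- The dehomogenization of a polynomial in the variables `X 0, …, X n`: the variable `X 0` is set
to `1`, and the remaining ones are renumbered from `0`. -/
noncomputable def dehomogenize {n : ℕ} (p : MvPolynomial (Fin (n + 1)) R) :
    MvPolynomial (Fin n) R :=
  aeval (Fin.cons 1 X : Fin (n + 1) → MvPolynomial (Fin n) R) p

theorem totalDegree_dehomogenize_le [Nontrivial R] {n : ℕ} (p : MvPolynomial (Fin (n + 1)) R) :
    (dehomogenize p).totalDegree ≤ p.totalDegree := by
  refine (totalDegree_aeval_le p (d := 1) fun i => ?_).trans_eq (mul_one _)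
  cases i using Fin.cases <;> simp

theorem eval_dehomogenize {n : ℕ} (p : MvPolynomial (Fin (n + 1)) R) (y : Fin n → R) :
    eval y (dehomogenize p) = eval (Fin.cons 1 y : Fin (n + 1) → R) p := by
  rw [dehomogenize, ← aeval_eq_eval, ← aeval_eq_eval, ← AlgHom.comp_apply, comp_aeval]
  congr 2
  funext i
  cases i using Fin.cases <;> simp

/-- The odd part of a polynomial, made homogeneous of degree `2 * N + 1` by multiplying its
components with powers of the quadratic form `∑ j, X j ^ 2`, which is `1` on the unit sphere.
Components of degree above `2 * N + 1` are discarded. -/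
noncomputable def oddForm [Fintype σ] (N : ℕ) (p : MvPolynomial σ R) : MvPolynomial σ R :=
  ∑ k ∈ Finset.range (N + 1), homogeneousComponent (2 * k + 1) p * (∑ j, X j ^ 2) ^ (N - k)

theorem isHomogeneous_oddForm [Fintype σ] (N : ℕ) (p : MvPolynomial σ R) :
    (oddForm N p).IsHomogeneous (2 * N + 1) := by
  refine IsHomogeneous.sum _ _ _ fun k hk => ?_
  have degree_eq : 2 * N + 1 = (2 * k + 1) + 2 * (N - k) := by
    have := Finset.mem_range.1 hk
    omega
  rw [degree_eq]
  exact (homogeneousComponent_isHomogeneous _ _).mul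
    ((IsHomogeneous.sum _ _ _ fun j _ => isHomogeneous_X_pow j 2).pow _)

theorem sum_range_two_mul_one_sub_neg_one_pow_mul {S : Type*} [CommRing S] (a : ℕ → S) (N : ℕ) :
    ∑ i ∈ Finset.range (2 * N), (1 - (-1) ^ i) * a i =
      2 * ∑ k ∈ Finset.range N, a (2 * k + 1) := by
  induction N with
  | zero => simp
  | succ N ih =>
    rw [mul_add_one, Finset.sum_range_succ, Finset.sum_range_succ, ih, Finset.sum_range_succ]
    simp only [pow_succ, pow_mul]
    ring

theorem two_mul_eval_oddForm {S : Type*} [CommRing S] [Fintype σ] {N : ℕ} {p : MvPolynomial σ S}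
    (hp : p.totalDegree ≤ 2 * N + 1) {x : σ → S} (hx : ∑ j, x j ^ 2 = 1) :
    2 * eval x (oddForm N p) = eval x p - eval (-x) p := by
  have eval_neg (i : ℕ) : eval (-x) (homogeneousComponent i p) =
      (-1) ^ i * eval x (homogeneousComponent i p) := by
    rw [← eval_smul_of_isHomogeneous (homogeneousComponent_isHomogeneous i p), neg_one_smul]
  calc 2 * eval x (oddForm N p)
      = 2 * ∑ k ∈ Finset.range (N + 1), eval x (homogeneousComponent (2 * k + 1) p) := by
        simp [oddForm, hx]
    _ = ∑ i ∈ Finset.range (2 * (N + 1)),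
          (eval x (homogeneousComponent i p) - eval (-x) (homogeneousComponent i p)) := by
        rw [← sum_range_two_mul_one_sub_neg_one_pow_mul
          fun i => eval x (homogeneousComponent i p)]
        simp only [eval_neg, sub_mul, one_mul]
    _ = eval x p - eval (-x) p := by
        rw [Finset.sum_sub_distrib, ← map_sum, ← map_sum,
          sum_range_homogeneousComponent (by omega)]

end Polynomials

section AdicMonomials

open MvPolynomial

variable {σ R : Type*} [Fintype σ]

/-- The monomial `∏ i, X i ^ m i` with each full power `X i ^ d` replaced by `h i`. When these
products form a basis, they expand polynomials in the system `h` the way digits expand a number in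
base `d`. -/
noncomputable def adicMonomial [CommSemiring R] (d : ℕ) (h : σ → MvPolynomial σ R) (m : σ →₀ ℕ) :
    MvPolynomial σ R :=
  ∏ i, X i ^ (m i % d) * h i ^ (m i / d)

theorem totalDegree_adicMonomial_le [CommSemiring R] [Nontrivial R] {d : ℕ}
    {h : σ → MvPolynomial σ R} (hh : ∀ i, (h i).totalDegree ≤ d) (m : σ →₀ ℕ) :
    (adicMonomial d h m).totalDegree ≤ m.degree := by
  rw [Finsupp.degree_eq_sum]
  refine (totalDegree_finsetProd _ _).trans (Finset.sum_le_sum fun i _ => ?_)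
  calc (X i ^ (m i % d) * h i ^ (m i / d)).totalDegree
      ≤ m i % d + m i / d * (h i).totalDegree :=
        (totalDegree_mul _ _).trans (add_le_add (totalDegree_X_pow _ _).le (totalDegree_pow _ _))
    _ ≤ m i % d + m i / d * d := by gcongr; exact hh i
    _ = m i := Nat.mod_add_div' _ _

theorem map_adicMonomial {S : Type*} [CommSemiring R] [CommSemiring S] (f : R →+* S) (d : ℕ)
    (h : σ → MvPolynomial σ R) (m : σ →₀ ℕ) :
    map f (adicMonomial d h m) = adicMonomial d (fun i => map f (h i)) m := by
  simp [adicMonomial]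

theorem adicMonomial_X_pow [CommSemiring R] (d : ℕ) (m : σ →₀ ℕ) :
    adicMonomial d (fun i => X i ^ d : σ → MvPolynomial σ R) m = monomial m 1 := by
  simp only [adicMonomial, ← pow_mul, ← pow_add, Nat.mod_add_div]
  rw [monomial_eq, C_1, one_mul, Finsupp.prod_fintype _ _ fun i => pow_zero _]

theorem adicMonomial_add_single [CommSemiring R] {d : ℕ} (hd : 0 < d) (h : σ → MvPolynomial σ R)
    (m : σ →₀ ℕ) (i : σ) :
    adicMonomial d h (m + Finsupp.single i d) = h i * adicMonomial d h m := by
  classical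
  simp only [adicMonomial, ← Finset.mul_prod_erase Finset.univ _ (Finset.mem_univ i)]
  have other_factors : ∀ j ∈ Finset.univ.erase i,
      X j ^ ((m + Finsupp.single i d) j % d) * h j ^ ((m + Finsupp.single i d) j / d) =
        X j ^ (m j % d) * h j ^ (m j / d) := fun j hj => by
    simp [(Finset.ne_of_mem_erase hj).symm]
  rw [Finset.prod_congr rfl other_factors]
  simp only [Finsupp.add_apply, Finsupp.single_eq_same, Nat.add_mod_right,
    Nat.add_div_right _ hd, pow_succ]
  ring

theorem restrictScalars_span_range_eq_span_adicMonomial [CommSemiring R] {d : ℕ} (hd : 0 < d)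
    {h : σ → MvPolynomial σ R} (hspan : Submodule.span R (Set.range (adicMonomial d h)) = ⊤) :
    (Ideal.span (Set.range h)).restrictScalars R =
      Submodule.span R (adicMonomial d h '' {m | ∀ i, m i < d}ᶜ) := by
  set J := Submodule.span R (adicMonomial d h '' {m | ∀ i, m i < d}ᶜ)
  apply le_antisymm
  · have mul_mem (i : σ) (p : MvPolynomial σ R) : p * h i ∈ J := by
      have hp : p ∈ Submodule.span R (Set.range (adicMonomial d h)) := hspan ▸ Submodule.mem_top
      induction hp using Submodule.span_induction with
      | mem _ hx =>
        obtain ⟨m, rfl⟩ := hx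
        rw [mul_comm, ← adicMonomial_add_single hd]
        exact Submodule.subset_span ⟨_, fun hlt => by simpa using hlt i, rfl⟩
      | zero => simp
      | add _ _ _ _ hx hy => rw [add_mul]; exact J.add_mem hx hy
      | smul c _ _ hx => rw [smul_mul_assoc]; exact J.smul_mem c hx
    intro p hp
    obtain ⟨c, rfl⟩ := Ideal.mem_span_range_iff_exists_fun.1 hp
    exact J.sum_mem fun i _ => mul_mem i (c i)
  · refine Submodule.span_le.2 ?_
    rintro _ ⟨m, hm, rfl⟩
    obtain ⟨i, hi⟩ : ∃ i, d ≤ m i := by simpa using hm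
    rw [← tsub_add_cancel_of_le (Finsupp.single_le_iff.2 hi), adicMonomial_add_single hd]
    exact Ideal.mul_mem_right _ _ (Ideal.subset_span ⟨i, rfl⟩)

theorem card_setOf_forall_lt (σ : Type*) [Fintype σ] (d : ℕ) :
    Nat.card {m : σ →₀ ℕ | ∀ i, m i < d} = d ^ Fintype.card σ := by
  let e : {m : σ →₀ ℕ | ∀ i, m i < d} ≃ (σ → Fin d) :=
    (Finsupp.equivFunOnFinite.subtypeEquiv fun _ => Iff.rfl).trans
      (Equiv.subtypePiEquivPi.trans (Equiv.piCongrRight fun _ => Fin.equivSubtype.symm))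
  simp [Nat.card_congr e, Nat.card_fun]

theorem finrank_quotient_span_range [CommRing R] [Nontrivial R] {d : ℕ} (hd : 0 < d)
    {h : σ → MvPolynomial σ R} (hli : LinearIndependent R (adicMonomial d h))
    (hspan : Submodule.span R (Set.range (adicMonomial d h)) = ⊤) :
    Module.finrank R (MvPolynomial σ R ⧸ Ideal.span (Set.range h)) = d ^ Fintype.card σ := by
  have hcompl := hli.isCompl_span_image hspan (isCompl_compl (x := {m | ∀ i, m i < d})).symm
  rw [← restrictScalars_span_range_eq_span_adicMonomial hd hspan] at hcompl
  rw [← (Submodule.Quotient.restrictScalarsEquiv R (Ideal.span (Set.range h))).finrank_eq,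
    (Submodule.quotientEquivOfIsCompl _ _ hcompl).finrank_eq, finrank_span_image_eq_card hli,
    card_setOf_forall_lt]

theorem countable_setOf_not_linearIndependent_adicMonomial [CommRing R] [IsDomain R] (d : ℕ)
    (g : σ → MvPolynomial σ R) :
    {t : R | ¬ LinearIndependent R (adicMonomial d fun i => X i ^ d + C t * g i)}.Countable := by
  classical
  let h : σ → MvPolynomial σ (Polynomial R) :=
    fun i => X i ^ d + C Polynomial.X * map Polynomial.C (g i)
  let A : Matrix (σ →₀ ℕ) (σ →₀ ℕ) (Polynomial R) := fun m m' => coeff m' (adicMonomial d h m)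
  have map_h (t : R) (i : σ) : map (Polynomial.evalRingHom t) (h i) = X i ^ d + C t * g i := by
    have : (Polynomial.evalRingHom t).comp Polynomial.C = RingHom.id R := by ext; simp
    simp [h, map_map, this, MvPolynomial.map_id]
  have map_A (t : R) (m m' : σ →₀ ℕ) : A.map (Polynomial.eval t) m m' =
      coeff m' (adicMonomial d (fun i => X i ^ d + C t * g i) m) := by
    simp only [← map_h, ← map_adicMonomial, coeff_map]
    rfl
  have map_A_zero : A.map (Polynomial.eval 0) = 1 := by
    ext m m'
    rw [map_A]
    simp [adicMonomial_X_pow, coeff_monomial, Matrix.one_apply]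
  refine (countable_setOf_not_linearIndependent_row_map_eval A map_A_zero).mono fun t => mt ?_
  intro hrow
  refine LinearIndependent.of_comp (LinearMap.pi fun m' => lcoeff R m') ?_
  have comp_eq : (LinearMap.pi fun m' => lcoeff R m') ∘
      adicMonomial d (fun i => X i ^ d + C t * g i) = (A.map (Polynomial.eval t)).row :=
    funext fun m => funext fun m' => (map_A t m m').symm
  exact comp_eq ▸ hrow

end AdicMonomials

section OddSystems

open MvPolynomial

theorem exists_gt_pow_add_mul_eval_eq_zero {σ : Type*} [Finite σ] {d : ℕ} (hd : Odd d)
    {g : σ → MvPolynomial σ ℝ} (hg : ∀ i, (g i).totalDegree ≤ d) (r : ℝ) :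
    ∃ t > r, ∃ y : σ → ℝ, ∀ i, y i ^ d + t * eval y (g i) = 0 := by
  have := Fintype.ofFinite σ
  obtain ⟨t, hli, ht⟩ := ((countable_setOf_not_linearIndependent_adicMonomial d g).dense_compl
    ℝ).exists_mem_open isOpen_Ioi (Set.nonempty_Ioi (a := r))
  have hli : LinearIndependent ℝ (adicMonomial d fun i => X i ^ d + C t * g i) := not_not.1 hli
  have hdeg (i : σ) : (X i ^ d + C t * g i).totalDegree ≤ d := by
    refine (totalDegree_add _ _).trans (max_le (totalDegree_X_pow i d).le ?_)
    exact (totalDegree_mul _ _).trans (by simpa using hg i)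
  have hspan := span_range_eq_top_of_totalDegree_le hli (totalDegree_adicMonomial_le hdeg)
  obtain ⟨y, hy⟩ := exists_forall_mem_eval_eq_zero_of_odd_finrank _
    (finrank_quotient_span_range hd.pos hli hspan ▸ hd.pow)
  exact ⟨t, ht, y, fun i => by simpa using hy _ (Ideal.subset_span ⟨i, rfl⟩)⟩

theorem exists_unitSphere_pow_add_mul_eval_eq_zero {n d : ℕ} (hd : Odd d)
    {f : Fin n → MvPolynomial (Fin (n + 1)) ℝ} (hf : ∀ i, (f i).IsHomogeneous d) (r : ℝ) :
    ∃ t > r, ∃ z : UnitSphere n, ∀ i, z.1 i.succ ^ d + t * eval z.1.ofLp (f i) = 0 := by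
  obtain ⟨t, ht, y, hy⟩ := exists_gt_pow_add_mul_eval_eq_zero hd
    (fun i => (totalDegree_dehomogenize_le (f i)).trans (hf i).totalDegree_le) r
  let x : EuclideanSpace ℝ (Fin (n + 1)) := WithLp.toLp 2 (Fin.cons 1 y)
  have hx : x ≠ 0 := fun h => by simpa [x] using congrArg (fun v => v.ofLp 0) h
  refine ⟨t, ht, ⟨‖x‖⁻¹ • x, by simpa using norm_smul_inv_norm (𝕜 := ℝ) hx⟩, fun i => ?_⟩
  have hyi : y i ^ d + t * eval x.ofLp (f i) = 0 := by rw [← hy i, eval_dehomogenize]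
  calc (‖x‖⁻¹ • x) i.succ ^ d + t * eval (‖x‖⁻¹ • x.ofLp) (f i)
      = ‖x‖⁻¹ ^ d * (y i ^ d + t * eval x.ofLp (f i)) := by
        rw [eval_smul_of_isHomogeneous (hf i)]
        simp only [x, PiLp.smul_apply, Fin.cons_succ, smul_eq_mul, mul_pow]
        ring
    _ = 0 := by rw [hyi, mul_zero]

theorem exists_unitSphere_abs_eval_le {n d : ℕ} (hd : Odd d)
    {f : Fin n → MvPolynomial (Fin (n + 1)) ℝ} (hf : ∀ i, (f i).IsHomogeneous d)
    {ε : ℝ} (hε : 0 < ε) : ∃ z : UnitSphere n, ∀ i, |eval z.1.ofLp (f i)| ≤ ε := by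
  obtain ⟨t, ht, z, hz⟩ := exists_unitSphere_pow_add_mul_eval_eq_zero hd hf ε⁻¹
  have ht₀ : 0 < t := (inv_pos.2 hε).trans ht
  refine ⟨z, fun i => ?_⟩
  have abs_coord_le : |z.1 i.succ| ≤ 1 :=
    (PiLp.norm_apply_le z.1 i.succ).trans_eq (mem_sphere_zero_iff_norm.1 z.2)
  have mul_abs_le : t * |eval z.1.ofLp (f i)| ≤ 1 := calc
    t * |eval z.1.ofLp (f i)| = |t * eval z.1.ofLp (f i)| := by rw [abs_mul, abs_of_pos ht₀]
    _ = |z.1 i.succ| ^ d := by rw [eq_neg_of_add_eq_zero_right (hz i), abs_neg, abs_pow]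
    _ ≤ 1 := pow_le_one₀ (abs_nonneg _) abs_coord_le
  calc |eval z.1.ofLp (f i)| ≤ 1 / t := (le_div_iff₀' ht₀).2 mul_abs_le
    _ = t⁻¹ := one_div t
    _ ≤ ε := inv_le_of_inv_le₀ hε ht.le

end OddSystems

section BorsukUlam

open MvPolynomial

theorem exists_mvPolynomial_near_of_injective {T σ : Type*} [TopologicalSpace T] [CompactSpace T]
    {x : σ → C(T, ℝ)} (hx : Function.Injective fun t i => x i t) (f : C(T, ℝ)) {ε : ℝ}
    (hε : 0 < ε) : ∃ p : MvPolynomial σ ℝ, ∀ t, |eval (fun i => x i t) p - f t| < ε := by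
  have hsep : (aeval (R := ℝ) x).range.SeparatesPoints := by
    intro s t hst
    obtain ⟨i, hi⟩ := Function.ne_iff.1 (hx.ne hst)
    exact ⟨x i, ⟨x i, ⟨X i, aeval_X x i⟩, rfl⟩, hi⟩
  obtain ⟨⟨_, p, rfl⟩, hp⟩ :=
    ContinuousMap.exists_mem_subalgebra_near_continuousMap_of_separatesPoints _ hsep f ε hε
  have aeval_apply (t : T) : aeval x p t = eval (fun i => x i t) p := by
    rw [← aeval_eq_eval]
    exact DFunLike.congr_fun (comp_aeval x (ContinuousMap.evalAlgHom ℝ ℝ t)) p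
  refine ⟨p, fun t => ?_⟩
  simpa [← aeval_apply] using (ContinuousMap.norm_coe_le_norm _ t).trans_lt hp

theorem exists_unitSphere_norm_apply_le_of_odd {n : ℕ} (h : C(UnitSphere n, Fin n → ℝ))
    (hodd : ∀ z, h (-z) = -h z) {ε : ℝ} (hε : 0 < ε) : ∃ z, ‖h z‖ ≤ ε := by
  let coord (j : Fin (n + 1)) : C(UnitSphere n, ℝ) := ⟨fun z => z.1 j, by fun_prop⟩
  have coord_injective : Function.Injective fun z j => coord j z :=
    fun z w hzw => Subtype.ext (PiLp.ext (congrFun hzw))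
  choose p hp using fun i : Fin n => exists_mvPolynomial_near_of_injective coord_injective
    (⟨fun z => h z i, by fun_prop⟩ : C(UnitSphere n, ℝ)) (half_pos hε)
  let N := Finset.univ.sup fun i => (p i).totalDegree
  have hN (i : Fin n) : (p i).totalDegree ≤ 2 * N + 1 := by
    have : (p i).totalDegree ≤ N := Finset.le_sup (f := fun i => (p i).totalDegree) (by simp)
    omega
  obtain ⟨z, hz⟩ := exists_unitSphere_abs_eval_le (odd_two_mul_add_one N)
    (fun i => isHomogeneous_oddForm N (p i)) (half_pos hε)
  refine ⟨z, (pi_norm_le_iff_of_nonneg hε.le).2 fun i => ?_⟩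
  have sum_sq : ∑ j, z.1 j ^ 2 = 1 := by
    rw [← EuclideanSpace.real_norm_sq_eq, mem_sphere_zero_iff_norm.1 z.2, one_pow]
  have odd_part : 2 * eval z.1.ofLp (oddForm N (p i)) =
      eval z.1.ofLp (p i) - eval (-z.1.ofLp) (p i) :=
    two_mul_eval_oddForm (hN i) sum_sq
  have near_z : |eval z.1.ofLp (p i) - h z i| < ε / 2 := hp i z
  have near_neg_z : |eval (-z.1.ofLp) (p i) - -h z i| < ε / 2 := by
    have := hp i (-z)
    rwa [ContinuousMap.coe_mk, hodd] at this
  obtain ⟨lower_z, upper_z⟩ := abs_lt.1 near_z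
  obtain ⟨lower_neg_z, upper_neg_z⟩ := abs_lt.1 near_neg_z
  obtain ⟨lower_form, upper_form⟩ := abs_le.1 (hz i)
  rw [Real.norm_eq_abs, abs_le]
  constructor <;> linarith

theorem exists_unitSphere_eq_zero_of_odd {n : ℕ} (h : C(UnitSphere n, Fin n → ℝ))
    (hodd : ∀ z, h (-z) = -h z) : ∃ z, h z = 0 := by
  have : Nonempty (UnitSphere n) := (NormedSpace.sphere_nonempty.2 zero_le_one).to_subtype
  obtain ⟨z₀, -, hz₀⟩ := isCompact_univ.exists_isMinOn Set.univ_nonempty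
    (f := fun z => ‖h z‖) (by fun_prop)
  refine ⟨z₀, norm_le_zero_iff.1 (le_of_forall_pos_le_add fun ε hε => ?_)⟩
  obtain ⟨z, hz⟩ := exists_unitSphere_norm_apply_le_of_odd h hodd hε
  exact (hz₀ (Set.mem_univ z)).trans (hz.trans_eq (zero_add ε).symm)

theorem exists_unitSphere_apply_neg_eq {n : ℕ} (h : C(UnitSphere n, EuclideanSpace ℝ (Fin n))) :
    ∃ z, h (-z) = h z := by
  obtain ⟨z, hz⟩ := exists_unitSphere_eq_zero_of_odd
    (⟨fun z => (h (-z) - h z).ofLp, by fun_prop⟩ : C(UnitSphere n, Fin n → ℝ))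
    (fun z => by simp)
  exact ⟨z, sub_eq_zero.1 (WithLp.ofLp_injective 2 hz)⟩

end BorsukUlam

theorem enorm_le_of_enorm_sub_le_of_enorm_neg_sub_le {X : Type*} [NormedAddCommGroup X]
    [NormedSpace ℝ X] {x y : X} {r : ℝ≥0∞} (hx : ‖x - y‖ₑ ≤ r) (hneg : ‖-x - y‖ₑ ≤ r) :
    ‖x‖ₑ ≤ r := by
  have two_mul_le : 2 * ‖x‖ₑ ≤ 2 * r := calc
    2 * ‖x‖ₑ = ‖(2 : ℝ) • x‖ₑ := by simp [enorm_smul, Real.enorm_eq_ofReal]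
    _ = ‖(x - y) - (-x - y)‖ₑ := by rw [two_smul, sub_sub_sub_cancel_right, sub_neg_eq_add]
    _ ≤ ‖x - y‖ₑ + ‖-x - y‖ₑ := enorm_sub_le
    _ ≤ 2 * r := (add_le_add hx hneg).trans_eq (two_mul r).symm
  exact (ENNReal.mul_le_mul_iff_right two_ne_zero ENNReal.ofNat_ne_top).1 two_mul_le

theorem mainTheorem4_general {X : Type*} [NormedAddCommGroup X] [NormedSpace ℝ X]
    (n : ℕ) (K : Set X) : sphereEmbeddingWidth n K ≤ manifoldWidth n K := by
  refine iSup₂_le fun c hc => le_iInf₂ fun a M => ?_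
  obtain ⟨z, hz⟩ := exists_unitSphere_apply_neg_eq (a.comp c)
  have error_le (w : UnitSphere n) : ‖(c w : X) - M (a (c w))‖ₑ ≤ ⨆ f : K, ‖(f : X) - M (a f)‖ₑ :=
    le_iSup (fun f : K => ‖(f : X) - M (a f)‖ₑ) (c w)
  have error_neg_le := error_le (-z)
  rw [show a (c (-z)) = a (c z) from hz, hc] at error_neg_le
  exact (iInf_le _ z).trans (enorm_le_of_enorm_sub_le_of_enorm_neg_sub_le (error_le z) error_neg_le)

theorem mainTheorem4 {X : Type*} [NormedAddCommGroup X] [NormedSpace ℝ X] [CompleteSpace X]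
    (n : ℕ) (K : Set X) (hK : IsCompact K) :
    sphereEmbeddingWidth n K ≤ manifoldWidth n K :=
  mainTheorem4_general n K
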